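/- Let $m$ and $i$ be positive integers. A word $w$ over an $m$-letter alphabet encounters a pattern $p=p_1\cdots p_n$ in the abelian sense if $w$ contains a factor $u_1\cdots u_n$ with nonempty words $u_1,\dots,u_n$ such that $u_j$ is a rearrangement of the letters of $u_k$ whenever $p_j=p_k$. The pattern $p$ is $m$-unavoidable in the abelian sense if only words of bounded length over an $m$-letter alphabet fail to encounter $p$ in the abelian sense; its abelian Ramsey length $L_{\mathrm{ab}}(m,p)$ is then the least $n$ such that every word of length $n$ over an $m$-letter alphabet encounters $p$ in the abelian sense. The Zimin patterns are $Z_1=a_1$ and $Z_i=Z_{i-1}a_iZ_{i-1}$ for $i\ge 2$, with distinct variables $a_1,a_2,\dots$. For every $m\ge 4$ and $i\ge 1$ the pattern $Z_i$ is $m$-unavoidable in the abelian sense; for every $m\ge 4$ and $j\ge 1$ the series $$S_j=S_j(m)=\sum_{\ell=1}^{\infty}\frac{1}{m^{2^j\ell}}\sum_{i_1+\cdots+i_m=\ell}\binom{\ell}{i_1,\ldots,i_m}^{2^j}$$ (the inner sum being over nonnegative integers $i_1,\dots,i_m$) converges; and for all $m\ge 4$ and $i\ge 2$ $$L_{\mathrm{ab}}(m,Z_i)\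 \ge\ (1+o(1))\sqrt{2\prod_{j=1}^{i-1}S_j^{-1}},$$ where $o(1)$ stands for a function of $(m,i)$ that tends to $0$ as $m+i\to\infty$ (in particular as $i\to\infty$ for fixed $m$, and as $m\to\infty$ for fixed $i$). -/

import Mathlib

open Filter Topology

/-- The word `w` encounters the pattern `p = p₁ ⋯ pₙ` in the abelian sense: `w` contains a factor
`u₁ ⋯ uₙ` where the `uⱼ` are nonempty words and `uⱼ` is a rearrangement of `uₖ` whenever
`pⱼ = pₖ`. -/
def AbelianEncounters {V A : Type*} (p : List V) (w : List A) : Prop :=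
  ∃ u : Fin p.length → List A,
    (∀ j, u j ≠ []) ∧
    (∀ j k, p.get j = p.get k → (u j).Perm (u k)) ∧
    (List.ofFn u).flatten <:+: w

/-- `p` is `m`-avoidable in the abelian sense: arbitrarily long words over an `m`-letter alphabet
avoid `p` in the abelian sense. -/
def AbelianAvoidable {V : Type*} (m : ℕ) (p : List V) : Prop :=
  ∀ N : ℕ, ∃ w : List (Fin m), N ≤ w.length ∧ ¬ AbelianEncounters p w

/-- The abelian Ramsey length of a pattern `p` that is `m`-unavoidable in the abelian sense: the
least `n` such that every word of length `n` over an `m`-letter alphabet encounters `p` in the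
abelian sense. -/
noncomputable def abelianRamseyLength {V : Type*} (m : ℕ) (p : List V) : ℕ :=
  sInf {n : ℕ | ∀ w : List (Fin m), w.length = n → AbelianEncounters p w}

/-- The Zimin patterns, with the variable `aᵢ` represented by the number `i`: `Z₁ = a₁` and
`Zᵢ = Zᵢ₋₁ aᵢ Zᵢ₋₁` (and `Z₀` is the empty word). -/
def zimin : ℕ → List ℕ
  | 0 => []
  | i + 1 => zimin i ++ [i + 1] ++ zimin i

/-- The term `m ^ (-k ℓ) * ∑_{i₁ + ⋯ + iₘ = ℓ} (ℓ; i₁, …, iₘ) ^ k`. -/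
noncomputable def multinomialTerm (m k l : ℕ) : ℝ :=
  (1 / (m : ℝ) ^ (k * l)) *
    ∑ c ∈ Finset.piAntidiag (Finset.univ : Finset (Fin m)) l,
      (Nat.multinomial Finset.univ c : ℝ) ^ k

/-- The number `∑_{ℓ ≥ 1} m ^ (-k ℓ) * ∑_{i₁ + ⋯ + iₘ = ℓ} (ℓ; i₁, …, iₘ) ^ k`. -/
noncomputable def multinomialSeries (m k : ℕ) : ℝ :=
  ∑' l : ℕ, multinomialTerm m k (l + 1)

/-!
The lower bound is the first moment method. If every word of length `n` contains an instance of
`x v z` in the abelian sense, fix the letter counts of the words substituted for the variables of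
`x` and `z` and the two ends of the word substituted for `v`, which can be chosen in at most
`n ^ 2 / 2` ways. A uniformly random word contains such an instance with probability at most the
product, over the occurrences of variables in `x` and `z`, of the multinomial probabilities of their
letter counts. Summing over the letter counts turns a variable that occurs `k` times in `x` and `z`
into the factor `∑ₗ m ^ (-k l) ∑ (l; i₁, …, iₘ) ^ k`. For `x = z = Zᵢ₋₁` the multiplicities are
`2, 4, …, 2 ^ (i - 1)`, so `2 ≤ n ^ 2 S₁ ⋯ Sᵢ₋₁` and the bound holds with `o(1) = 0`.

The series converge because the largest probability of the multinomial distribution with `l` trials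
and `m` equally likely outcomes is of order at most `l ^ (-(m - 1) / 2)`.

Unavoidability holds even for instances with equal words: if every word of length `N` contains an
instance of `Zᵢ`, a sufficiently long word has a factor `y x y` with `|y| = N` by the pigeonhole
principle, and an instance of `Zᵢ` inside `y` extends to one of `Zᵢ₊₁`.
-/

theorem factorial_le_exp_one_mul_sqrt_mul_div_exp_pow {n : ℕ} (hn : n ≠ 0) :
    (n.factorial : ℝ) ≤ Real.exp 1 * √n * (n / Real.exp 1) ^ n := by
  obtain ⟨k, rfl⟩ := Nat.exists_eq_succ_of_ne_zero hn
  have h : Stirling.stirlingSeq (k + 1) ≤ Real.exp 1 / √2 :=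
    Stirling.stirlingSeq_one ▸ Stirling.stirlingSeq'_antitone (Nat.zero_le k)
  rw [Stirling.stirlingSeq, div_le_iff₀ (by positivity)] at h
  refine h.trans_eq ?_
  rw [Real.sqrt_mul (by positivity)]
  field_simp

theorem pow_div_factorial_le_pow_div_factorial {x : ℝ} {c n : ℕ} (hcn : c ≤ n) (hnx : n ≤ x) :
    x ^ c / c.factorial ≤ x ^ n / n.factorial := by
  have hx : 0 ≤ x := n.cast_nonneg.trans hnx
  obtain ⟨d, rfl⟩ := Nat.exists_eq_add_of_le hcn
  have hfac : ((c + d).factorial : ℝ) ≤ c.factorial * x ^ d := by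
    calc ((c + d).factorial : ℝ) ≤ c.factorial * ((c + d : ℕ) : ℝ) ^ d := by
          rw [← Nat.factorial_mul_ascFactorial]
          exact_mod_cast Nat.mul_le_mul_left _ (Nat.ascFactorial_le_pow_add c d)
      _ ≤ c.factorial * x ^ d := by gcongr
  rw [div_le_div_iff₀ (by positivity) (by positivity)]
  calc x ^ c * (c + d).factorial ≤ x ^ c * (c.factorial * x ^ d) := by gcongr
    _ = x ^ (c + d) * c.factorial := by ring

theorem div_pow_le_exp_sub {x : ℝ} (hx : 0 ≤ x) (n : ℕ) :
    (x / n) ^ n ≤ Real.exp (x - n) := by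
  rcases eq_or_ne n 0 with rfl | hn
  · simpa using hx
  calc (x / n) ^ n ≤ Real.exp (x / n - 1) ^ n := by
        gcongr
        linarith [Real.add_one_le_exp (x / n - 1)]
    _ = Real.exp (x - n) := by
        rw [← Real.exp_nat_mul]
        congr 1
        field_simp

theorem pow_div_factorial_le_exp_div_sqrt_two_mul {x : ℝ} (hx : 0 ≤ x) {n : ℕ} (hn : n ≠ 0) :
    x ^ n / n.factorial ≤ Real.exp x / √(2 * n) := by
  have hstirling : √(2 * n) * (n / Real.exp 1) ^ n ≤ (n.factorial : ℝ) := by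
    refine le_trans ?_ (Stirling.le_factorial_stirling n)
    gcongr
    linarith [Real.pi_gt_three]
  rw [div_le_div_iff₀ (by positivity) (by positivity)]
  calc x ^ n * √(2 * n)
      = (x / n) ^ n * Real.exp 1 ^ n * (√(2 * n) * (n / Real.exp 1) ^ n) := by
        rw [div_pow, div_pow]
        field_simp
    _ ≤ Real.exp (x - n) * Real.exp 1 ^ n * n.factorial := by
        gcongr
        exact div_pow_le_exp_sub hx n
    _ = Real.exp x * n.factorial := by
        rw [← Real.exp_nat_mul, mul_one, ← Real.exp_add, sub_add_cancel]

/-- The left side is largest at `n = ⌊x⌋`, the mode of the Poisson distribution of mean `x`. -/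
theorem pow_div_factorial_le_exp_div_sqrt {x : ℝ} (hx : 0 < x) (n : ℕ) :
    x ^ n / n.factorial ≤ Real.exp x / √x := by
  rcases lt_or_ge x 1 with hx1 | hx1
  · refine (Real.pow_div_factorial_le_exp x hx.le n).trans ?_
    exact le_div_self (Real.exp_pos x).le (Real.sqrt_pos.2 hx) (Real.sqrt_le_one.2 hx1.le)
  have hfloor : 1 ≤ ⌊x⌋₊ := Nat.one_le_floor_iff x |>.2 hx1
  have of_floor_le : ∀ q : ℕ, ⌊x⌋₊ ≤ q → x ^ q / q.factorial ≤ Real.exp x / √x := by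
    intro q hq
    refine (pow_div_factorial_le_exp_div_sqrt_two_mul hx.le (by omega)).trans ?_
    have hq' : (⌊x⌋₊ : ℝ) ≤ q := by exact_mod_cast hq
    have hq1 : (1 : ℝ) ≤ ⌊x⌋₊ := by exact_mod_cast hfloor
    gcongr
    linarith [Nat.lt_floor_add_one x]
  rcases le_total n ⌊x⌋₊ with h | h
  · exact (pow_div_factorial_le_pow_div_factorial h (Nat.floor_le hx.le)).trans
      (of_floor_le _ le_rfl)
  · exact of_floor_le n h

section LetterCounts

variable {A : Type*} [Fintype A]

/-- The probability that a uniformly random word of length `∑ a, c a` over the alphabet `A` has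
exactly `c a` occurrences of each letter `a`. -/
noncomputable def letterCountProb (c : A → ℕ) : ℝ :=
  Nat.multinomial Finset.univ c / (Fintype.card A : ℝ) ^ ∑ a, c a

theorem letterCountProb_nonneg (c : A → ℕ) : 0 ≤ letterCountProb c := by
  unfold letterCountProb
  positivity

theorem sum_piAntidiag_letterCountProb [DecidableEq A] [Nonempty A] (l : ℕ) :
    ∑ c ∈ Finset.piAntidiag (Finset.univ : Finset A) l, letterCountProb c = 1 := by
  have hmultinomial := Finset.sum_pow_eq_sum_piAntidiag Finset.univ (fun _ : A => (1 : ℝ)) l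
  simp only [Finset.sum_const, Finset.card_univ, nsmul_eq_mul, mul_one, one_pow,
    Finset.prod_const_one] at hmultinomial
  calc ∑ c ∈ Finset.piAntidiag (Finset.univ : Finset A) l, letterCountProb c
      = ∑ c ∈ Finset.piAntidiag (Finset.univ : Finset A) l,
          (Nat.multinomial Finset.univ c : ℝ) / (Fintype.card A : ℝ) ^ l :=
        Finset.sum_congr rfl fun c hc => by
          rw [letterCountProb, (Finset.mem_piAntidiag.1 hc).1]
    _ = 1 := by rw [← Finset.sum_div, ← hmultinomial, div_self (by positivity)]

/-- Conditioning independent Poisson variables of mean `(∑ a, c a) / |A|` on their sum gives the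
multinomial distribution, so the bound is that of `pow_div_factorial_le_exp_div_sqrt` for each
letter together with Stirling's formula for the sum. -/
theorem letterCountProb_le {c : A → ℕ} (hc : ∑ a, c a ≠ 0) :
    letterCountProb c ≤
      Real.exp 1 * √(Fintype.card A) ^ Fintype.card A / √(∑ a, c a : ℕ) ^ (Fintype.card A - 1) := by
  obtain ⟨a, -⟩ := Finset.nonempty_of_sum_ne_zero hc
  obtain ⟨d, hd⟩ := Nat.exists_eq_succ_of_ne_zero (Fintype.card_pos_iff.2 ⟨a⟩).ne'
  set l := ∑ a, c a with hl
  set m := Fintype.card A with hcard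
  have hm : (0 : ℝ) < m := by rw [hd]; positivity
  have : (0 : ℝ) < l := by positivity
  have hpoisson : ∏ a, ((l / m : ℝ) ^ c a / (c a).factorial) ≤
      (Real.exp (l / m) / √(l / m)) ^ m := by
    refine (Finset.prod_le_prod (fun a _ => by positivity) fun a _ =>
      pow_div_factorial_le_exp_div_sqrt (by positivity) (c a)).trans_eq ?_
    rw [Finset.prod_const, Finset.card_univ]
  have hmultinomial : (Nat.multinomial Finset.univ c : ℝ) * ∏ a, ((c a).factorial : ℝ) =
      l.factorial := by
    rw [mul_comm]
    exact_mod_cast Nat.multinomial_spec Finset.univ c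
  have hfactor : letterCountProb c =
      l.factorial / (l : ℝ) ^ l * ∏ a, ((l / m : ℝ) ^ c a / (c a).factorial) := by
    rw [letterCountProb, Finset.prod_div_distrib, Finset.prod_pow_eq_pow_sum, ← hl, ← hcard,
      ← hmultinomial, div_pow]
    field_simp
  calc letterCountProb c
      ≤ Real.exp 1 * √l * (l / Real.exp 1) ^ l / (l : ℝ) ^ l *
          (Real.exp (l / m) / √(l / m)) ^ m := by
        rw [hfactor]
        gcongr
        exact factorial_le_exp_one_mul_sqrt_mul_div_exp_pow hc
    _ = Real.exp 1 * √l * (√m / √l) ^ m := by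
        have hexp : Real.exp (l / m) ^ m = Real.exp 1 ^ l := by
          rw [← Real.exp_nat_mul, ← Real.exp_nat_mul]
          congr 1
          field_simp
        rw [Real.sqrt_div (by positivity), div_pow, div_pow, div_pow, div_pow, hexp]
        field_simp
    _ = Real.exp 1 * √m ^ m / √l ^ (m - 1) := by
        rw [div_pow, hd, Nat.succ_eq_add_one, Nat.add_sub_cancel, pow_succ (√(l : ℝ))]
        field_simp

end LetterCounts

theorem sum_pow_succ_le_pow_mul_sum {ι : Type*} {s : Finset ι} {f : ι → ℝ} {b : ℝ}
    (hf : ∀ i ∈ s, 0 ≤ f i) (hb : ∀ i ∈ s, f i ≤ b) (k : ℕ) :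
    ∑ i ∈ s, f i ^ (k + 1) ≤ b ^ k * ∑ i ∈ s, f i := by
  rw [Finset.mul_sum]
  refine Finset.sum_le_sum fun i hi => ?_
  rw [pow_succ]
  have := hf i hi
  gcongr
  exact hb i hi

theorem multinomialTerm_eq_sum_letterCountProb (m k l : ℕ) :
    multinomialTerm m k l =
      ∑ c ∈ Finset.piAntidiag (Finset.univ : Finset (Fin m)) l, letterCountProb c ^ k := by
  rw [multinomialTerm, Finset.mul_sum]
  refine Finset.sum_congr rfl fun c hc => ?_
  rw [letterCountProb, Fintype.card_fin, (Finset.mem_piAntidiag.1 hc).1, div_pow, ← pow_mul,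
    mul_comm l k, one_div_mul_eq_div]

theorem multinomialTerm_nonneg (m k l : ℕ) : 0 ≤ multinomialTerm m k l := by
  unfold multinomialTerm
  positivity

theorem multinomialTerm_succ_le {m : ℕ} [NeZero m] (k : ℕ) {l : ℕ} (hl : l ≠ 0) :
    multinomialTerm m (k + 1) l ≤
      (Real.exp 1 * √m ^ m) ^ k / √l ^ ((m - 1) * k) := by
  calc multinomialTerm m (k + 1) l
      = ∑ c ∈ Finset.piAntidiag (Finset.univ : Finset (Fin m)) l, letterCountProb c ^ (k + 1) :=
        multinomialTerm_eq_sum_letterCountProb m (k + 1) l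
    _ ≤ (Real.exp 1 * √m ^ m / √l ^ (m - 1)) ^ k *
          ∑ c ∈ Finset.piAntidiag (Finset.univ : Finset (Fin m)) l, letterCountProb c := by
        refine sum_pow_succ_le_pow_mul_sum (fun c _ => letterCountProb_nonneg c) (fun c hc => ?_) k
        have hsum := (Finset.mem_piAntidiag.1 hc).1
        simpa only [hsum, Fintype.card_fin] using letterCountProb_le (hsum.trans_ne hl)
    _ = (Real.exp 1 * √m ^ m) ^ k / √l ^ ((m - 1) * k) := by
        rw [sum_piAntidiag_letterCountProb, mul_one, div_pow, ← pow_mul]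

theorem summable_multinomialTerm {m k : ℕ} (h : 2 < (m - 1) * (k - 1)) :
    Summable fun l : ℕ => multinomialTerm m k (l + 1) := by
  obtain ⟨k, rfl⟩ : ∃ k', k = k' + 1 := Nat.exists_eq_succ_of_ne_zero (by rintro rfl; simp at h)
  have : NeZero m := ⟨by rintro rfl; simp at h⟩
  rw [Nat.add_sub_cancel] at h
  have hp : (1 : ℝ) < ((m - 1) * k : ℕ) / 2 := by
    rw [one_lt_div two_pos]
    exact_mod_cast h
  have hpow (l : ℕ) : √((l + 1 : ℕ) : ℝ) ^ ((m - 1) * k) =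
      ((l + 1 : ℕ) : ℝ) ^ ((((m - 1) * k : ℕ) : ℝ) / 2) := by
    rw [Real.sqrt_eq_rpow, ← Real.rpow_natCast, ← Real.rpow_mul (by positivity)]
    congr 1
    ring
  refine Summable.of_nonneg_of_le (fun l => multinomialTerm_nonneg _ _ _)
    (fun l => multinomialTerm_succ_le k l.succ_ne_zero) ?_
  simp only [hpow, div_eq_mul_inv _ (_ ^ _)]
  exact ((summable_nat_add_iff 1).2 (Real.summable_nat_rpow_inv.2 hp)).mul_left _

section WordMass

variable {A : Type*} [Fintype A]

/-- The mass of a finite set of words in which a word of length `n` weighs `|A|⁻ⁿ`, so that the mass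
of a set of words of length `n` is the probability that a random word of length `n` belongs to it.
Lengths may be mixed, which makes the mass submultiplicative under concatenation. -/
noncomputable def wordMass (W : Finset (List A)) : ℝ :=
  ∑ w ∈ W, ((Fintype.card A : ℝ) ^ w.length)⁻¹

theorem wordMass_nonneg (W : Finset (List A)) : 0 ≤ wordMass W := by
  unfold wordMass
  positivity

theorem wordMass_eq_card_div {W : Finset (List A)} {n : ℕ} (hW : ∀ w ∈ W, w.length = n) :
    wordMass W = W.card / (Fintype.card A : ℝ) ^ n := by
  rw [wordMass, Finset.sum_congr rfl fun w hw => by rw [hW w hw], Finset.sum_const, nsmul_eq_mul,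
    div_eq_mul_inv]

end WordMass

section Words

variable {A : Type*} [DecidableEq A]

theorem count_ofFn {n : ℕ} (f : Fin n → A) (a : A) :
    (List.ofFn f).count a = (∑ i, Finsupp.single (f i) 1 : A →₀ ℕ) a := by
  induction n with
  | zero => simp
  | succ n ih =>
    simp [List.ofFn_succ, List.count_cons, Fin.sum_univ_succ, ih, Finsupp.single_apply, add_comm]

/-- The concatenations `w₁ ⋯ wₙ` of words `wᵢ ∈ Wᵢ`, where `L` is the list of the sets `Wᵢ`. -/
def concatAll (L : List (Finset (List A))) : Finset (List A) :=
  L.foldr (Finset.image₂ (· ++ ·)) {[]}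

theorem concatAll_append (L M : List (Finset (List A))) :
    concatAll (L ++ M) = Finset.image₂ (· ++ ·) (concatAll L) (concatAll M) := by
  induction L with
  | nil => simp [concatAll]
  | cons W L ih =>
    calc concatAll (W :: L ++ M) = Finset.image₂ (· ++ ·) W (concatAll (L ++ M)) := rfl
      _ = Finset.image₂ (· ++ ·) (concatAll (W :: L)) (concatAll M) := by
        rw [ih]
        exact (Finset.image₂_assoc List.append_assoc).symm

theorem flatten_mem_concatAll {us : List (List A)} {L : List (Finset (List A))}
    (h : List.Forall₂ (· ∈ ·) us L) : us.flatten ∈ concatAll L := by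
  induction h with
  | nil => exact Finset.mem_singleton_self _
  | cons hu _ ih => exact Finset.mem_image₂_of_mem hu ih

variable [Fintype A]

/-- The finite set of words of length `n` over the alphabet `A`. -/
def wordsOfLength (A : Type*) [Fintype A] [DecidableEq A] (n : ℕ) : Finset (List A) :=
  (Finset.univ : Finset (Fin n → A)).image List.ofFn

theorem mem_wordsOfLength {n : ℕ} {w : List A} : w ∈ wordsOfLength A n ↔ w.length = n := by
  simp only [wordsOfLength, Finset.mem_image, Finset.mem_univ, true_and]
  constructor
  · rintro ⟨f, rfl⟩
    exact List.length_ofFn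
  · rintro rfl
    exact ⟨w.get, List.ofFn_get w⟩

theorem card_wordsOfLength (n : ℕ) : (wordsOfLength A n).card = Fintype.card A ^ n := by
  rw [wordsOfLength, Finset.card_image_of_injective _ List.ofFn_injective, Finset.card_univ,
    Fintype.card_fun, Fintype.card_fin]

theorem sum_count_eq_length (w : List A) : ∑ a, w.count a = w.length := by
  simpa only [Multiset.coe_count, Multiset.coe_card] using
    Multiset.sum_count_eq_card (s := Finset.univ) (m := (w : Multiset A))
      fun a _ => Finset.mem_univ a

/-- The finite set of words in which each letter `a` occurs exactly `c a` times. -/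
def wordsWithCounts (c : A → ℕ) : Finset (List A) :=
  {w ∈ wordsOfLength A (∑ a, c a) | ∀ a, w.count a = c a}

theorem mem_wordsWithCounts {c : A → ℕ} {w : List A} :
    w ∈ wordsWithCounts c ↔ ∀ a, w.count a = c a := by
  simp only [wordsWithCounts, Finset.mem_filter, mem_wordsOfLength, and_iff_right_iff_imp]
  intro h
  rw [← sum_count_eq_length]
  exact Finset.sum_congr rfl fun a _ => h a

theorem length_of_mem_wordsWithCounts {c : A → ℕ} {w : List A} (hw : w ∈ wordsWithCounts c) :
    w.length = ∑ a, c a :=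
  mem_wordsOfLength.1 (Finset.mem_filter.1 hw).1

/-- Both sides are the coefficient of `∏ a, X a ^ c a` in `(∑ a, X a) ^ ∑ a, c a`. -/
theorem card_wordsWithCounts (c : A → ℕ) :
    (wordsWithCounts c).card = Nat.multinomial Finset.univ c := by
  set n := ∑ a, c a
  set d : A →₀ ℕ := Finsupp.equivFunOnFinite.symm c with hd
  have hsum : d.sum (fun _ k => k) = n := Finsupp.sum_fintype _ _ fun _ => rfl
  have hcount (f : Fin n → A) :
      (∀ a, (List.ofFn f).count a = c a) ↔ ∑ i, Finsupp.single (f i) 1 = d := by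
    simp only [count_ofFn, Finsupp.ext_iff, hd, Finsupp.equivFunOnFinite_symm_apply_apply]
  calc (wordsWithCounts c).card
      = (Finset.univ.filter fun f : Fin n → A => ∑ i, Finsupp.single (f i) 1 = d).card := by
        rw [wordsWithCounts, wordsOfLength, Finset.filter_image,
          Finset.card_image_of_injective _ List.ofFn_injective]
        congr 1 with f
        simp only [Finset.mem_filter_univ, hcount]
    _ = ((∑ a, MvPolynomial.X a : MvPolynomial A ℕ) ^ n).coeff d := by
        simp only [Fintype.sum_pow, MvPolynomial.coeff_sum, Finset.card_filter, MvPolynomial.X,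
          ← MvPolynomial.monomial_sum_one, MvPolynomial.coeff_monomial]
    _ = Nat.multinomial Finset.univ c := by
        rw [MvPolynomial.coeff_sum_X_pow_of_fintype, if_pos hsum,
          Finsupp.multinomial_eq_of_support_subset (Finset.subset_univ _)]
        rfl

theorem wordMass_wordsOfLength [Nonempty A] (n : ℕ) : wordMass (wordsOfLength A n) = 1 := by
  rw [wordMass_eq_card_div fun _ => mem_wordsOfLength.1, card_wordsOfLength, Nat.cast_pow,
    div_self (by positivity)]

theorem wordMass_wordsWithCounts (c : A → ℕ) :
    wordMass (wordsWithCounts c) = letterCountProb c := by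
  rw [wordMass_eq_card_div fun _ => length_of_mem_wordsWithCounts, card_wordsWithCounts,
    letterCountProb]

theorem wordMass_le_sum_of_subset_biUnion {ι : Type*} {W : Finset (List A)} {s : Finset ι}
    {f : ι → Finset (List A)} (h : W ⊆ s.biUnion f) : wordMass W ≤ ∑ i ∈ s, wordMass (f i) := by
  calc wordMass W ≤ wordMass (s.biUnion f) :=
        Finset.sum_le_sum_of_subset_of_nonneg h fun w _ _ => by positivity
    _ ≤ ∑ i ∈ s, wordMass (f i) := by
        rw [← Finset.sup_eq_biUnion]
        refine Finset.apply_sup_le_sum Finset.sum_empty (fun {U W} => ?_) s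
        refine (le_add_of_nonneg_right (wordMass_nonneg (U ∩ W))).trans_eq ?_
        exact Finset.sum_union_inter

theorem wordMass_concatAll_le (L : List (Finset (List A))) :
    wordMass (concatAll L) ≤ (L.map wordMass).prod := by
  induction L with
  | nil => simp [concatAll, wordMass]
  | cons W L ih =>
    calc wordMass (concatAll (W :: L))
        ≤ ∑ q ∈ W ×ˢ concatAll L, ((Fintype.card A : ℝ) ^ (q.1 ++ q.2).length)⁻¹ :=
          Finset.sum_image_le_of_nonneg fun _ _ => by positivity
      _ = wordMass W * wordMass (concatAll L) := by
          simp only [wordMass, Finset.sum_mul_sum, Finset.sum_product, List.length_append, pow_add,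
            mul_inv]
      _ ≤ ((W :: L).map wordMass).prod :=
          mul_le_mul_of_nonneg_left ih (wordMass_nonneg W)

/-- The concatenations of words spelling out the pattern `p`, where the words substituted for the
variable `v` have letter counts `C v`. -/
def abelianInstances {V : Type*} (C : V → A → ℕ) (p : List V) : Finset (List A) :=
  concatAll (p.map fun v => wordsWithCounts (C v))

theorem abelianInstances_append {V : Type*} (C : V → A → ℕ) (p q : List V) :
    abelianInstances C (p ++ q) =
      Finset.image₂ (· ++ ·) (abelianInstances C p) (abelianInstances C q) := by
  rw [abelianInstances, List.map_append, concatAll_append, abelianInstances, abelianInstances]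

theorem abelianInstances_congr {V : Type*} {C D : V → A → ℕ} {p : List V}
    (h : ∀ v ∈ p, C v = D v) : abelianInstances C p = abelianInstances D p := by
  rw [abelianInstances, abelianInstances, List.map_congr_left fun v hv => by rw [h v hv]]

theorem length_of_mem_abelianInstances {V : Type*} {C : V → A → ℕ} {p : List V} {w : List A}
    (hw : w ∈ abelianInstances C p) : w.length = (p.map fun v => ∑ a, C v a).sum := by
  induction p generalizing w with
  | nil => simpa [abelianInstances, concatAll] using hw
  | cons v p ih =>
    obtain ⟨u, hu, t, ht, rfl⟩ := Finset.mem_image₂.1 hw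
    rw [List.length_append, length_of_mem_wordsWithCounts hu, ih ht, List.map_cons, List.sum_cons]

theorem wordMass_abelianInstances_le {V : Type*} (C : V → A → ℕ) (p : List V) :
    wordMass (abelianInstances C p) ≤ (p.map fun v => letterCountProb (C v)).prod := by
  refine (wordMass_concatAll_le _).trans_eq ?_
  simp only [List.map_map, Function.comp_def, wordMass_wordsWithCounts]

theorem AbelianEncounters.exists_mem_abelianInstances {V : Type*} {p : List V} {w : List A}
    (h : AbelianEncounters p w) :
    ∃ C : V → A → ℕ, (∀ v ∈ p, C v ≠ 0) ∧ ∃ y ∈ abelianInstances C p, y <:+: w := by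
  obtain ⟨u, hne, hperm, hinfix⟩ := h
  have hfactors : Function.FactorsThrough (fun j a => (u j).count a) p.get :=
    fun j k hjk => funext fun a => (hperm j k hjk).count_eq a
  set C : V → A → ℕ := Function.extend p.get (fun j a => (u j).count a) 0
  have hC (j : Fin p.length) : C (p.get j) = fun a => (u j).count a := hfactors.extend_apply 0 j
  refine ⟨C, fun v hv h0 => ?_, _, flatten_mem_concatAll ?_, hinfix⟩
  · obtain ⟨j, rfl⟩ := List.mem_iff_get.1 hv
    refine hne j (List.eq_nil_iff_forall_not_mem.2 fun a => ?_)
    exact List.count_eq_zero.1 (congrFun ((hC j).symm.trans h0) a)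
  · rw [List.forall₂_iff_get]
    refine ⟨by simp, fun j hj _ => ?_⟩
    rw [List.length_ofFn] at hj
    simpa [mem_wordsWithCounts] using fun a => (congrFun (hC ⟨j, hj⟩) a).symm

/-- The words `s x' y z' t` of length `n` with `|s| = i` and `|s y| = j`, where `x'` and `z'`
spell out the patterns `x` and `z` with the letter counts `C`. -/
def patternOccurrences {V : Type*} (C : V → A → ℕ) (x z : List V) (n i j : ℕ) :
    Finset (List A) :=
  concatAll [wordsOfLength A i, abelianInstances C x, wordsOfLength A (j - i),
    abelianInstances C z, wordsOfLength A (n - (j + ((x ++ z).map fun v => ∑ a, C v a).sum))]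

theorem append_mem_patternOccurrences {V : Type*} {C : V → A → ℕ} {x z : List V}
    {X Z : List A} (hX : X ∈ abelianInstances C x) (hZ : Z ∈ abelianInstances C z)
    (s Y t : List A) :
    s ++ (X ++ (Y ++ Z)) ++ t ∈ patternOccurrences C x z (s ++ (X ++ (Y ++ Z)) ++ t).length
      s.length (s.length + Y.length) := by
  have hflatten : s ++ (X ++ (Y ++ Z)) ++ t = [s, X, Y, Z, t].flatten := by simp
  rw [hflatten]
  refine flatten_mem_concatAll ?_
  simp only [List.forall₂_cons, mem_wordsOfLength, hX, hZ, List.Forall₂.nil, and_true, true_and,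
    ← hflatten, List.map_append, List.sum_append, ← length_of_mem_abelianInstances hX,
    ← length_of_mem_abelianInstances hZ, List.length_append]
  omega

theorem wordMass_patternOccurrences_le [Nonempty A] {V : Type*} [DecidableEq V]
    (C : V → A → ℕ) (x z : List V) (n i j : ℕ) :
    wordMass (patternOccurrences C x z n i j) ≤
      ∏ v ∈ (x ++ z).toFinset, letterCountProb (C v) ^ (x ++ z).count v := by
  rw [← Finset.prod_list_map_count, List.map_append, List.prod_append]
  refine (wordMass_concatAll_le _).trans ?_
  simp only [List.map_cons, List.map_nil, List.prod_cons, List.prod_nil, wordMass_wordsOfLength,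
    one_mul, mul_one]
  exact mul_le_mul (wordMass_abelianInstances_le C x) (wordMass_abelianInstances_le C z)
    (wordMass_nonneg _) (List.prod_nonneg (by simp [letterCountProb_nonneg]))

/-- The letter counts of the nonempty words of length at most `n`. -/
def nonzeroLetterCounts (A : Type*) [Fintype A] [DecidableEq A] (n : ℕ) : Finset (A → ℕ) :=
  (Finset.range n).biUnion fun l => Finset.piAntidiag Finset.univ (l + 1)

theorem mem_nonzeroLetterCounts {n : ℕ} {c : A → ℕ} :
    c ∈ nonzeroLetterCounts A n ↔ c ≠ 0 ∧ ∑ a, c a ≤ n := by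
  simp only [nonzeroLetterCounts, Finset.mem_biUnion, Finset.mem_range, Finset.mem_piAntidiag,
    Finset.mem_univ, implies_true, and_true]
  constructor
  · rintro ⟨l, hl, hc : ∑ a, c a = l + 1⟩
    refine ⟨?_, by omega⟩
    rintro rfl
    simp at hc
  · rintro ⟨h0, hn⟩
    have hpos : 0 < ∑ a, c a := Fintype.sum_pos (pos_iff_ne_zero.2 h0)
    exact ⟨∑ a, c a - 1, by omega, (Nat.sub_add_cancel hpos).symm⟩

theorem sum_nonzeroLetterCounts {M : Type*} [AddCommMonoid M] (n : ℕ) (g : (A → ℕ) → M) :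
    ∑ c ∈ nonzeroLetterCounts A n, g c =
      ∑ l ∈ Finset.range n, ∑ c ∈ Finset.piAntidiag Finset.univ (l + 1), g c := by
  refine Finset.sum_biUnion fun k _ l _ hkl => Finset.disjoint_left.2 fun c hck hcl => hkl ?_
  rw [Finset.mem_piAntidiag] at hck hcl
  exact Nat.succ_injective (hck.1.symm.trans hcl.1)

theorem AbelianEncounters.exists_mem_patternOccurrences {V : Type*} [DecidableEq V]
    {x z : List V} {v : V} {w : List A} (hxz : x ++ z ≠ [])
    (h : AbelianEncounters (x ++ v :: z) w) :
    ∃ C ∈ (x ++ z).toFinset.finsupp fun _ => nonzeroLetterCounts A w.length,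
      ∃ j < w.length, ∃ i < j, w ∈ patternOccurrences C x z w.length i j := by
  obtain ⟨C, hC0, y, hy, s, t, rfl⟩ := h.exists_mem_abelianInstances
  rw [abelianInstances_append] at hy
  obtain ⟨X, hX, YZ, hYZ, rfl⟩ := Finset.mem_image₂.1 hy
  obtain ⟨Y, hY, Z, hZ, rfl⟩ := Finset.mem_image₂.1 hYZ
  set D : V →₀ A → ℕ := Finsupp.indicator (x ++ z).toFinset fun u _ => C u
  have hD : ∀ u ∈ x ++ z, C u = D u := fun u hu =>
    (Finsupp.indicator_of_mem (List.mem_toFinset.2 hu) fun u _ => C u).symm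
  have hX' : X ∈ abelianInstances D x :=
    abelianInstances_congr (fun u hu => hD u (List.mem_append_left z hu)) ▸ hX
  have hZ' : Z ∈ abelianInstances D z :=
    abelianInstances_congr (fun u hu => hD u (List.mem_append_right x hu)) ▸ hZ
  have hXZ : ((x ++ z).map fun u => ∑ a, D u a).sum = X.length + Z.length := by
    rw [List.map_append, List.sum_append, length_of_mem_abelianInstances hX',
      length_of_mem_abelianInstances hZ']
  set w := s ++ (X ++ (Y ++ Z)) ++ t with hw
  have hwlen : w.length = s.length + (X.length + (Y.length + Z.length)) + t.length := by
    simp only [hw, List.length_append]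
  have hpos : ∀ u ∈ x ++ v :: z, 0 < ∑ a, C u a := fun u hu =>
    Fintype.sum_pos (pos_iff_ne_zero.2 (hC0 u hu))
  have hmem : ∀ u ∈ x ++ z, u ∈ x ++ v :: z :=
    ((List.sublist_cons_self v z).append_left x).subset
  have hle : ∀ u ∈ x ++ z, ∑ a, D u a ≤ X.length + Z.length := fun u hu =>
    hXZ ▸ List.le_sum_of_mem (List.mem_map_of_mem (f := fun u => ∑ a, D u a) hu)
  have hDmem : ∀ u ∈ x ++ z, D u ∈ nonzeroLetterCounts A w.length := fun u hu =>
    mem_nonzeroLetterCounts.2 ⟨hD u hu ▸ hC0 u (hmem u hu), (hle u hu).trans (by omega)⟩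
  have hYpos : 0 < Y.length :=
    length_of_mem_wordsWithCounts hY ▸ hpos v (by simp)
  have hXZpos : 0 < X.length + Z.length := by
    obtain ⟨u, hu⟩ := List.exists_mem_of_ne_nil _ hxz
    exact (hD u hu ▸ hpos u (hmem u hu)).trans_le (hle u hu)
  refine ⟨D, Finset.mem_finsupp_iff.2 ⟨Finsupp.support_indicator_subset _ _, by simpa using hDmem⟩,
    s.length + Y.length, by omega, s.length, by omega, append_mem_patternOccurrences hX' hZ' s Y t⟩

end Words

theorem sum_finsupp_prod {V M R : Type*} [Zero M] [CommSemiring R]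
    (T : Finset V) (S : V → Finset M) (g : V → M → R) :
    ∑ C ∈ T.finsupp S, ∏ v ∈ T, g v (C v) = ∏ v ∈ T, ∑ c ∈ S v, g v c := by
  classical
  rw [Finset.prod_sum, Finset.finsupp, Finset.sum_map]
  refine Finset.sum_congr (by congr!) fun C _ => ?_
  rw [← Finset.prod_attach]
  refine Finset.prod_congr rfl fun v _ => ?_
  simp [Finsupp.indicator_of_mem v.2]

theorem two_mul_sum_sum_range_const_le (n : ℕ) {r : ℝ} (hr : 0 ≤ r) :
    2 * ∑ j ∈ Finset.range n, ∑ _i ∈ Finset.range j, r ≤ n ^ 2 * r := by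
  have hcard : (∑ j ∈ Finset.range n, (j : ℝ)) * 2 ≤ n ^ 2 := by
    rw [← Nat.cast_sum]
    exact_mod_cast (Finset.sum_range_id_mul_two n).trans_le <|
      (Nat.mul_le_mul_left n (Nat.sub_le n 1)).trans_eq (sq n).symm
  simp only [Finset.sum_const, Finset.card_range, nsmul_eq_mul, ← Finset.sum_mul]
  calc 2 * ((∑ j ∈ Finset.range n, (j : ℝ)) * r)
      = (∑ j ∈ Finset.range n, (j : ℝ)) * 2 * r := by ring
    _ ≤ n ^ 2 * r := by gcongr

/-- The union bound over the letter counts of the variables of `x ++ z` and over the at most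
`n ^ 2 / 2` pairs of positions at which the gap that `v` fills can begin and end. -/
theorem two_le_sq_mul_prod_sum_letterCountProb_pow {V A : Type*} [DecidableEq V] [Fintype A]
    [DecidableEq A] [Nonempty A] {x z : List V} {v : V} {n : ℕ} (hxz : x ++ z ≠ [])
    (h : ∀ w : List A, w.length = n → AbelianEncounters (x ++ v :: z) w) :
    2 ≤ (n : ℝ) ^ 2 * ∏ u ∈ (x ++ z).toFinset,
      ∑ c ∈ nonzeroLetterCounts A n, letterCountProb c ^ (x ++ z).count u := by
  set 𝒞 := (x ++ z).toFinset.finsupp fun _ => nonzeroLetterCounts A n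
  set occurrences : ℕ → ℕ → Finset (List A) := fun j i =>
    𝒞.biUnion fun C => patternOccurrences C x z n i j
  have hcover : wordsOfLength A n ⊆
      (Finset.range n).biUnion fun j => (Finset.range j).biUnion (occurrences j) := by
    intro w hw
    obtain rfl := mem_wordsOfLength.1 hw
    obtain ⟨C, hC, j, hj, i, hi, hmem⟩ := (h w rfl).exists_mem_patternOccurrences hxz
    simp only [occurrences, Finset.mem_biUnion, Finset.mem_range]
    exact ⟨j, hj, i, hi, C, hC, hmem⟩
  have hmass (j i : ℕ) : wordMass (occurrences j i) ≤ ∏ u ∈ (x ++ z).toFinset,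
      ∑ c ∈ nonzeroLetterCounts A n, letterCountProb c ^ (x ++ z).count u := by
    calc wordMass (occurrences j i)
        ≤ ∑ C ∈ 𝒞, wordMass (patternOccurrences C x z n i j) :=
          wordMass_le_sum_of_subset_biUnion subset_rfl
      _ ≤ ∑ C ∈ 𝒞, ∏ u ∈ (x ++ z).toFinset, letterCountProb (C u) ^ (x ++ z).count u :=
          Finset.sum_le_sum fun C _ => wordMass_patternOccurrences_le C x z n i j
      _ = _ := sum_finsupp_prod _ _ fun u c => letterCountProb c ^ (x ++ z).count u
  calc (2 : ℝ) = 2 * wordMass (wordsOfLength A n) := by rw [wordMass_wordsOfLength, mul_one]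
    _ ≤ 2 * ∑ j ∈ Finset.range n, ∑ _i ∈ Finset.range j, ∏ u ∈ (x ++ z).toFinset,
          ∑ c ∈ nonzeroLetterCounts A n, letterCountProb c ^ (x ++ z).count u := by
        gcongr
        refine (wordMass_le_sum_of_subset_biUnion hcover).trans ?_
        gcongr with j
        refine (wordMass_le_sum_of_subset_biUnion subset_rfl).trans ?_
        gcongr with i
        exact hmass j i
    _ ≤ _ := two_mul_sum_sum_range_const_le n <| Finset.prod_nonneg fun u _ =>
        Finset.sum_nonneg fun c _ => pow_nonneg (letterCountProb_nonneg c) _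

theorem sum_nonzeroLetterCounts_letterCountProb_pow (m k n : ℕ) :
    ∑ c ∈ nonzeroLetterCounts (Fin m) n, letterCountProb c ^ k =
      ∑ l ∈ Finset.range n, multinomialTerm m k (l + 1) := by
  simp only [sum_nonzeroLetterCounts, multinomialTerm_eq_sum_letterCountProb]

theorem two_le_sq_mul_prod_multinomialSeries {V : Type*} [DecidableEq V] {m : ℕ} [NeZero m]
    {x z : List V} {v : V} {n : ℕ} (hxz : x ++ z ≠ [])
    (hsum : ∀ u ∈ x ++ z, Summable fun l : ℕ => multinomialTerm m ((x ++ z).count u) (l + 1))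
    (h : ∀ w : List (Fin m), w.length = n → AbelianEncounters (x ++ v :: z) w) :
    2 ≤ (n : ℝ) ^ 2 * ∏ u ∈ (x ++ z).toFinset, multinomialSeries m ((x ++ z).count u) := by
  refine (two_le_sq_mul_prod_sum_letterCountProb_pow hxz h).trans ?_
  simp only [sum_nonzeroLetterCounts_letterCountProb_pow]
  gcongr with u hu
  · exact fun u _ => Finset.sum_nonneg fun l _ => multinomialTerm_nonneg _ _ _
  · exact (hsum u (List.mem_toFinset.1 hu)).sum_le_tsum _ fun l _ => multinomialTerm_nonneg _ _ _

theorem sqrt_two_mul_prod_inv_multinomialSeries_le_abelianRamseyLength {V : Type*}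
    [DecidableEq V] {m : ℕ} [NeZero m] {x z : List V} {v : V} (hxz : x ++ z ≠ [])
    (hsum : ∀ u ∈ x ++ z, Summable fun l : ℕ => multinomialTerm m ((x ++ z).count u) (l + 1))
    (h : ¬ AbelianAvoidable m (x ++ v :: z)) :
    √(2 * ∏ u ∈ (x ++ z).toFinset, (multinomialSeries m ((x ++ z).count u))⁻¹) ≤
      abelianRamseyLength m (x ++ v :: z) := by
  have hne : {n : ℕ | ∀ w : List (Fin m), w.length = n →
      AbelianEncounters (x ++ v :: z) w}.Nonempty := by
    simp only [AbelianAvoidable, not_forall, not_exists, not_and, not_not] at h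
    exact h.imp fun N hN w hw => hN w hw.ge
  have hbound := two_le_sq_mul_prod_multinomialSeries hxz hsum (Nat.sInf_mem hne)
  rw [← abelianRamseyLength] at hbound
  set P := ∏ u ∈ (x ++ z).toFinset, multinomialSeries m ((x ++ z).count u)
  have hP : 0 < P := pos_of_mul_pos_right (two_pos.trans_le hbound) (sq_nonneg _)
  refine Real.sqrt_le_iff.2 ⟨Nat.cast_nonneg _, ?_⟩
  rwa [Finset.prod_inv_distrib, ← div_eq_mul_inv, div_le_iff₀ hP]

theorem mem_zimin {i v : ℕ} : v ∈ zimin i ↔ 1 ≤ v ∧ v ≤ i := by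
  induction i with
  | zero => simp [zimin, Nat.one_le_iff_ne_zero]
  | succ i ih => simp only [zimin, List.mem_append, List.mem_singleton, ih]; omega

theorem zimin_flatMap_congr {A : Type*} {i : ℕ} {f g : ℕ → List A} (h : ∀ v ≤ i, f v = g v) :
    (zimin i).flatMap f = (zimin i).flatMap g :=
  List.flatMap_congr fun v hv => h v (mem_zimin.1 hv).2

theorem count_zimin {i v : ℕ} (hv : 1 ≤ v) (hvi : v ≤ i) : (zimin i).count v = 2 ^ (i - v) := by
  induction i, hvi using Nat.le_induction with
  | base =>
    obtain ⟨i, rfl⟩ := Nat.exists_eq_succ_of_ne_zero (by omega : v ≠ 0)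
    have hnot : (zimin i).count (i + 1) = 0 :=
      List.count_eq_zero.2 fun h => Nat.not_succ_le_self i (mem_zimin.1 h).2
    simp [zimin, hnot]
  | succ i hvi ih =>
    have hne : v ≠ i + 1 := by omega
    simp only [zimin, List.count_append, List.count_singleton, ih, beq_iff_eq, hne.symm, if_false]
    rw [Nat.succ_sub hvi, pow_succ]
    ring

theorem abelianEncounters_of_flatMap_infix {V A : Type*} {p : List V} {w : List A} {f : V → List A}
    (hf : ∀ v, f v ≠ []) (h : p.flatMap f <:+: w) : AbelianEncounters p w := by
  refine ⟨fun j => f (p.get j), fun j => hf _, fun j k hjk => .of_eq (congrArg f hjk), ?_⟩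
  rwa [← Function.comp_def, ← List.map_ofFn, List.ofFn_get, ← List.flatMap_def]

theorem exists_append_append_infix_of_take_drop_eq {A : Type*} {w : List A} {N i j : ℕ}
    (hij : i + N < j) (hj : j ≤ w.length) (h : (w.drop i).take N = (w.drop j).take N) :
    ∃ x ≠ [], (w.drop i).take N ++ x ++ (w.drop i).take N <:+: w := by
  refine ⟨(w.drop (i + N)).take (j - (i + N)), ?_, w.take i, w.drop (j + N), ?_⟩
  · rw [← List.length_pos_iff, List.length_take, List.length_drop]
    omega
  · have hdrop (k l : ℕ) : (w.drop k).take l ++ w.drop (k + l) = w.drop k := by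
      rw [← List.drop_drop, List.take_append_drop]
    have hgap : (w.drop (i + N)).take (j - (i + N)) ++ w.drop j = w.drop (i + N) := by
      simpa only [Nat.add_sub_cancel' hij.le] using hdrop (i + N) (j - (i + N))
    conv_lhs => enter [1, 2, 2]; rw [h]
    simp only [List.append_assoc, hdrop, hgap, List.take_append_drop]

/-- Among `|A| ^ N + 1` disjoint blocks of length `N`, no two of them adjacent, two are equal. -/
theorem exists_append_append_infix (A : Type*) [Fintype A] (N : ℕ) {w : List A}
    (hw : (Fintype.card A ^ N + 1) * (N + 1) ≤ w.length) :
    ∃ x ≠ [], ∃ y : List A, y.length = N ∧ y ++ x ++ y <:+: w := by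
  classical
  set K := Fintype.card A ^ N
  set block : ℕ → List A := fun k => (w.drop (k * (N + 1))).take N with hblock
  have hend {k : ℕ} (hk : k < K + 1) : k * (N + 1) + (N + 1) ≤ w.length := by
    rw [← Nat.succ_mul]
    exact (Nat.mul_le_mul_right (N + 1) hk).trans hw
  have hlength {k : ℕ} (hk : k < K + 1) : (block k).length = N := by
    have := hend hk
    simp only [hblock, List.length_take, List.length_drop]
    omega
  obtain ⟨k, hk, l, hl, hne, heq⟩ := Finset.exists_ne_map_eq_of_card_lt_of_maps_to
    (s := Finset.range (K + 1)) (t := wordsOfLength A N) (f := block)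
    (by rw [card_wordsOfLength, Finset.card_range]; omega)
    fun k hk => mem_wordsOfLength.2 (hlength (Finset.mem_range.1 hk))
  rw [Finset.mem_range] at hk hl
  wlog hkl : k < l generalizing k l
  · exact this l hl k hk hne.symm heq.symm (by omega)
  have hgap : k * (N + 1) + N < l * (N + 1) := by
    have := Nat.mul_le_mul_right (N + 1) hkl
    rw [Nat.succ_mul] at this
    omega
  have := hend hl
  obtain ⟨x, hx, hinfix⟩ := exists_append_append_infix_of_take_drop_eq hgap (by omega) heq
  exact ⟨x, hx, block k, hlength hk, hinfix⟩

theorem exists_forall_zimin_flatMap_infix (A : Type*) [Finite A] (i : ℕ) :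
    ∃ N : ℕ, ∀ w : List A, N ≤ w.length →
      ∃ f : ℕ → List A, (∀ v, f v ≠ []) ∧ (zimin i).flatMap f <:+: w := by
  have := Fintype.ofFinite A
  induction i with
  | zero =>
    exact ⟨1, fun w hw => ⟨fun _ => w, fun _ => List.length_pos_iff.1 hw, List.nil_infix⟩⟩
  | succ i ih =>
    obtain ⟨N, hN⟩ := ih
    refine ⟨(Fintype.card A ^ N + 1) * (N + 1), fun w hw => ?_⟩
    obtain ⟨x, hx, y, rfl, hyxy⟩ := exists_append_append_infix A N hw
    obtain ⟨f, hf, s, t, hy⟩ := hN y le_rfl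
    refine ⟨Function.update f (i + 1) (t ++ x ++ s), fun v => ?_, List.IsInfix.trans ?_ hyxy⟩
    · rcases eq_or_ne v (i + 1) with rfl | hv
      · simp [hx]
      · simpa only [Function.update_of_ne hv] using hf v
    · have hzimin : (zimin i).flatMap (Function.update f (i + 1) (t ++ x ++ s)) =
          (zimin i).flatMap f :=
        zimin_flatMap_congr fun v hv => Function.update_of_ne (by omega) _ _
      refine ⟨s, t, ?_⟩
      rw [zimin, List.flatMap_append, List.flatMap_append, hzimin, List.flatMap_singleton,
        Function.update_self]
      simp only [← hy, List.append_assoc]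

theorem not_abelianAvoidable_zimin (m i : ℕ) : ¬ AbelianAvoidable m (zimin i) := by
  intro h
  obtain ⟨N, hN⟩ := exists_forall_zimin_flatMap_infix (Fin m) i
  obtain ⟨w, hw, havoids⟩ := h N
  obtain ⟨f, hf, hinfix⟩ := hN w hw
  exact havoids (abelianEncounters_of_flatMap_infix hf hinfix)

theorem two_lt_sub_one_mul_two_pow_sub_one {m j : ℕ} (hm : 4 ≤ m) (hj : 1 ≤ j) :
    2 < (m - 1) * (2 ^ j - 1) := by
  have hpow : 2 ^ 1 ≤ 2 ^ j := Nat.pow_le_pow_right two_pos hj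
  calc 2 < 3 * 1 := by norm_num
    _ ≤ (m - 1) * (2 ^ j - 1) := Nat.mul_le_mul (by omega) (by omega)

theorem toFinset_zimin_append_zimin (i : ℕ) :
    (zimin i ++ zimin i).toFinset = Finset.Icc 1 i := by
  ext v
  simp [mem_zimin]

theorem count_zimin_append_zimin {i v : ℕ} (hv : 1 ≤ v) (hvi : v ≤ i) :
    (zimin i ++ zimin i).count v = 2 ^ (i + 1 - v) := by
  rw [List.count_append, count_zimin hv hvi, Nat.succ_sub hvi, pow_succ, mul_two]

theorem prod_count_zimin_append_zimin {M : Type*} [CommMonoid M] (i : ℕ) (g : ℕ → M) :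
    ∏ v ∈ (zimin i ++ zimin i).toFinset, g ((zimin i ++ zimin i).count v) =
      ∏ j ∈ Finset.Icc 1 i, g (2 ^ j) := by
  have hmaps : ∀ v ∈ Finset.Icc 1 i, i + 1 - v ∈ Finset.Icc 1 i := fun v hv => by
    rw [Finset.mem_Icc] at hv ⊢
    omega
  have hinv : ∀ v ∈ Finset.Icc 1 i, i + 1 - (i + 1 - v) = v := fun v hv =>
    Nat.sub_sub_self ((Finset.mem_Icc.1 hv).2.trans i.le_succ)
  rw [toFinset_zimin_append_zimin]
  refine Finset.prod_nbij' (i + 1 - ·) (i + 1 - ·) hmaps hmaps hinv hinv fun v hv => ?_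
  rw [count_zimin_append_zimin (Finset.mem_Icc.1 hv).1 (Finset.mem_Icc.1 hv).2]

theorem sqrt_two_mul_prod_inv_multinomialSeries_le_abelianRamseyLength_zimin {m i : ℕ}
    (hm : 4 ≤ m) (hi : 2 ≤ i) :
    √(2 * ∏ j ∈ Finset.Icc 1 (i - 1), (multinomialSeries m (2 ^ j))⁻¹) ≤
      abelianRamseyLength m (zimin i) := by
  obtain ⟨k, rfl⟩ := Nat.exists_eq_add_of_le' (one_le_two.trans hi)
  have : NeZero m := ⟨by omega⟩
  have hzimin : zimin (k + 1) = zimin k ++ (k + 1) :: zimin k := by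
    rw [zimin, List.append_assoc, List.singleton_append]
  have hne : zimin k ++ zimin k ≠ [] :=
    List.ne_nil_of_mem (List.mem_append_left _ (mem_zimin.2 ⟨le_rfl, Nat.le_of_succ_le_succ hi⟩))
  have hsum : ∀ v ∈ zimin k ++ zimin k,
      Summable fun l : ℕ => multinomialTerm m ((zimin k ++ zimin k).count v) (l + 1) := by
    intro v hv
    obtain ⟨hv1, hvk⟩ : 1 ≤ v ∧ v ≤ k := by simpa [mem_zimin] using hv
    rw [count_zimin_append_zimin hv1 hvk]
    exact summable_multinomialTerm (two_lt_sub_one_mul_two_pow_sub_one hm (by omega))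
  rw [Nat.add_sub_cancel,
    ← prod_count_zimin_append_zimin k fun n => (multinomialSeries m n)⁻¹, hzimin]
  exact sqrt_two_mul_prod_inv_multinomialSeries_le_abelianRamseyLength hne hsum
    (hzimin ▸ not_abelianAvoidable_zimin m (k + 1))

theorem mainTheorem11_general :
    (∀ m k : ℕ, 2 < (m - 1) * (k - 1) → Summable fun l : ℕ => multinomialTerm m k (l + 1)) ∧
    (∀ m i : ℕ, ¬ AbelianAvoidable m (zimin i)) ∧
    ∀ m : ℕ, 4 ≤ m → ∀ i : ℕ, 2 ≤ i →
      √(2 * ∏ j ∈ Finset.Icc 1 (i - 1), (multinomialSeries m (2 ^ j))⁻¹) ≤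
        abelianRamseyLength m (zimin i) :=
  ⟨fun _ _ => summable_multinomialTerm, not_abelianAvoidable_zimin, fun _ hm _ hi =>
    sqrt_two_mul_prod_inv_multinomialSeries_le_abelianRamseyLength_zimin hm hi⟩

theorem mainTheorem11 :
    -- the series `S_j` converge
    (∀ m : ℕ, 4 ≤ m → ∀ j : ℕ, 1 ≤ j →
      Summable (fun l : ℕ => multinomialTerm m (2 ^ j) (l + 1))) ∧
    -- the abelian Ramsey lengths are defined
    (∀ m : ℕ, 4 ≤ m → ∀ i : ℕ, 1 ≤ i → ¬ AbelianAvoidable m (zimin i)) ∧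
    -- the lower bound; `ε m i` is the `o(1)`, which tends to `0` as `m + i → ∞`
    ∃ ε : ℕ → ℕ → ℝ,
      Tendsto (fun q : ℕ × ℕ => ε q.1 q.2) cofinite (𝓝 0) ∧
      ∀ m : ℕ, 4 ≤ m → ∀ i : ℕ, 2 ≤ i →
        (1 + ε m i) *
            Real.sqrt (2 * ∏ j ∈ Finset.Icc 1 (i - 1), (multinomialSeries m (2 ^ j))⁻¹)
          ≤ (abelianRamseyLength m (zimin i) : ℝ) := by
  obtain ⟨hsummable, hunavoidable, hbound⟩ := mainTheorem11_general
  refine ⟨fun m hm j hj => hsummable m (2 ^ j) (two_lt_sub_one_mul_two_pow_sub_one hm hj),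
    fun m _ i _ => hunavoidable m i, fun _ _ => 0, tendsto_const_nhds, fun m hm i hi => ?_⟩
  simpa only [add_zero, one_mul] using hbound m hm i hi
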